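/- All graphs are finite and simple, and $N[v]$ denotes the closed neighborhood of a vertex $v$ (the vertex $v$ together with all its neighbors). In the Maker-Breaker domination game on a graph $G=(V,E)$, two players, Dominator and Staller, alternately claim an unclaimed vertex of $G$. Dominator wins if at some point the vertices she has claimed form a dominating set of $G$, i.e. a set meeting $N[v]$ for every $v\in V$; otherwise Staller wins. We write $o(G)=\mathcal{D}$ if Dominator has a winning strategy whoever starts. A pairing dominating set of $G$ is a set of pairs of vertices $\{(u_1,v_1),\dots,(u_k,v_k)\}$ such that the $2k$ vertices $u_1,v_1,\dots,u_k,v_k$ are all distinct and $$V=\bigcup_{i=1}^k \bigl(N[u_i]\cap N[v_i]\bigr).$$ A graph is an interval graph if it is the intersection graph of a family of nonempty closed intervals of $\mathbb{R}$: each vertex corresponds to an interval, and two distinct vertices are adjacent if and only if their intervals intersect. **Theorem.** Let $G$ be an interval graph. Then $o(G)=\mathcal{D}$ if and only if $G$ admits a pairing dominating set. Likewise, Dominator has a winning strategy on $G$ as the second player if and only if $G$ admits a pairing dominating set. -/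

import Mathlib

/-- The closed neighborhood `N[v]`: the vertex `v` and all its neighbors. -/
def closedNbhd {V : Type*} (G : SimpleGraph V) (v : V) : Set V :=
  insert v (G.neighborSet v)

/-- `X` is a dominating set of `G`: every closed neighborhood meets `X`. -/
def IsDominatingSet {V : Type*} (G : SimpleGraph V) (X : Set V) : Prop :=
  ∀ v : V, (X ∩ closedNbhd G v).Nonempty

/-- `G` is an interval graph: it is the intersection graph of a family of (nonempty) closed
intervals `[l v, r v]` of the real line. -/
def IsIntervalGraph {V : Type*} (G : SimpleGraph V) : Prop :=
  ∃ l r : V → ℝ, (∀ v, l v ≤ r v) ∧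
    ∀ u v : V, u ≠ v →
      (G.Adj u v ↔ (Set.Icc (l u) (r u) ∩ Set.Icc (l v) (r v)).Nonempty)

/-- `G` has a pairing dominating set: pairs `(u 0, v 0), …, (u (k-1), v (k-1))` of vertices, all
`2 k` vertices being distinct, such that the sets `N[u i] ∩ N[v i]` cover all vertices. -/
def HasPairingDominatingSet {V : Type*} (G : SimpleGraph V) : Prop :=
  ∃ (k : ℕ) (u v : Fin k → V), Function.Injective (Sum.elim u v) ∧
    (⋃ i : Fin k, closedNbhd G (u i) ∩ closedNbhd G (v i)) = Set.univ

/-- The two players of the Maker-Breaker domination game. -/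
inductive Player where
  | dominator
  | staller

/-- `DominatorWins G p D S`: in the Maker-Breaker domination game on the finite graph `G`,
Dominator has a winning strategy from the position in which the vertices of `D` are claimed by
Dominator, those of `S` are claimed by Staller, and player `p` is to move.

Dominator has won as soon as her vertices form a dominating set. Otherwise the player to move
claims one unclaimed vertex: Dominator needs one winning move, and against Staller she needs to
win after every possible move. If all vertices are claimed and Dominator's do not form a dominating
set, she has lost. -/
inductive DominatorWins {V : Type*} [DecidableEq V] (G : SimpleGraph V) :
    Player → Finset V → Finset V → Prop where
  | dominated (p : Player) (D S : Finset V) (h : IsDominatingSet G (D : Set V)) :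
      DominatorWins G p D S
  | dominatorMove (D S : Finset V) (x : V) (hx : x ∉ D ∪ S)
      (h : DominatorWins G Player.staller (insert x D) S) :
      DominatorWins G Player.dominator D S
  | stallerMove (D S : Finset V) (hne : ∃ x : V, x ∉ D ∪ S)
      (h : ∀ x : V, x ∉ D ∪ S → DominatorWins G Player.dominator D (insert x S)) :
      DominatorWins G Player.staller D S

/-- Dominator has a winning strategy on `G` as the second player (all vertices are unclaimed and
Staller starts). -/
def DominatorWinsSecond {V : Type*} [DecidableEq V] (G : SimpleGraph V) : Prop :=
  DominatorWins G Player.staller ∅ ∅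

/-- `o(G) = 𝒟`: Dominator has a winning strategy on `G` whoever starts. -/
def HasOutcomeD {V : Type*} [DecidableEq V] (G : SimpleGraph V) : Prop :=
  ∀ starter : Player, DominatorWins G starter ∅ ∅

/-!
A pairing dominating set lets Dominator win whoever starts: she answers in the pair in which Staller
has just played (`dominatorWins_of_pairing`). The converse is a duality for intervals on a line.

The closed neighborhoods of the vertices with inclusion-minimal intervals suffice for domination,
and since these intervals have their left ends in the order of their right ends, membership in the
neighborhoods can be described by points `t` of a finite set `T` of reals and one new interval
`[a x, b x]` for each vertex `x`: the vertex `x` lies in the neighborhood encoded by `t` if and only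
if `t ∈ [a x, b x]` (`IsIntervalGraph.exists_points`). A pairing dominating set is then a family of
disjoint pairs of intervals such that each point of `T` is in both intervals of some pair
(`PairCover`).

The obstruction to such a cover is a thin set `U ⊆ T` (`Thin`). In each window of `U` there is a
point, or a pair of consecutive points, that at most one interval with its trace on `U` inside the
window contains. Staller, to move, wins on a thin set: taking the window of all of `U`, she claims
the one vertex whose interval connects the two sides of this place. Dominator's answer meets at most
one side, and the other side is thin again (`Thin.exists_reply`). So in the end some point lies in
no interval claimed by Dominator.

That a pair cover or a thin set exists (`pairCover_or_exists_thin`) is proved by induction on the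
number of intervals. At the least point `m`, if at most one interval contains `m`, then `{m}` is
thin. Otherwise let `P`, `P'` be the two intervals at `m` that end first, and use them as a pair. If
the remaining intervals do not cover the points beyond `P`, they have a thin set `T₂` there, and
either `T₂` or `{m} ∪ T₂` is thin for all intervals, or a beginning of `{m} ∪ T₂` is thin for the
intervals `H` (`leftPart`) that end no later than `P'` and, except for `P` and `P'`, avoid `m`. In
this last case take a thin set `U` for `H` whose last point `q` is as far to the left as possible,
so that `H` has a pair cover of the points before `q`. Contract everything up to the end of `P'` to
the point `q`, and `H` to one interval `{q}`. A pair cover of the contraction extends, by an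
exchange argument, to a pair cover of all points (`pairCover_of_contraction`), and a thin set of the
contraction yields a thin set when `q` is replaced by `U` (`Thin.expand`).
-/

/-! ### Pair covers -/

section PairCover

variable {ι α : Type*} [DecidableEq ι]

/-- `PairCover N F T`: there are pairwise disjoint pairs of elements of `F` such that every point
of `T` lies in both of the sets `N x`, `N y` of some pair `{x, y}`. -/
inductive PairCover (N : ι → Set α) : Finset ι → Set α → Prop where
  | nil (F : Finset ι) : PairCover N F ∅
  | pair {F : Finset ι} {T : Set α} {x y : ι} (hx : x ∈ F) (hy : y ∈ F) (hxy : x ≠ y)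
      (h : PairCover N ((F.erase x).erase y) (T \ (N x ∩ N y))) : PairCover N F T

namespace PairCover

variable {N N' : ι → Set α} {F F' : Finset ι} {T T' : Set α}

theorem mono (h : PairCover N F T) : ∀ {F' : Finset ι} {T' : Set α}, F ⊆ F' → T' ⊆ T →
    (∀ x ∈ F, ∀ t ∈ T', t ∈ N x → t ∈ N' x) → PairCover N' F' T' := by
  induction h with
  | nil F =>
    intro F' T' _ hT _
    obtain rfl := Set.subset_empty_iff.1 hT
    exact nil _
  | @pair F T x y hx hy hxy _ ih =>
    intro F' T' hF hT hN
    refine pair (hF hx) (hF hy) hxy (ih ?_ ?_ ?_)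
    · exact Finset.erase_subset_erase _ (Finset.erase_subset_erase _ hF)
    · exact fun t ht => ⟨hT ht.1, fun h' =>
        ht.2 ⟨hN x hx t ht.1 h'.1, hN y hy t ht.1 h'.2⟩⟩
    · exact fun w hw t ht => hN w (Finset.mem_of_mem_erase (Finset.mem_of_mem_erase hw)) t ht.1

theorem mono' (h : PairCover N F T) (hF : F ⊆ F') (hT : T' ⊆ T) : PairCover N F' T' :=
  h.mono hF hT fun _ _ _ _ h => h

theorem union (h : PairCover N F T) : ∀ {F' : Finset ι} {T' : Set α}, PairCover N F' T' →
    Disjoint F F' → PairCover N (F ∪ F') (T ∪ T') := by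
  induction h with
  | nil F =>
    intro F' T' h' _
    exact h'.mono' Finset.subset_union_right (by simp)
  | @pair F T x y hx hy hxy _ ih =>
    intro F' T' h' hd
    have hd' : Disjoint ((F.erase x).erase y) F' :=
      hd.mono_left ((Finset.erase_subset _ _).trans (Finset.erase_subset _ _))
    refine pair (Finset.mem_union_left _ hx) (Finset.mem_union_left _ hy) hxy
      ((ih h' hd').mono' ?_ ?_)
    · intro w hw
      have hx' := Finset.disjoint_left.1 hd hx
      have hy' := Finset.disjoint_left.1 hd hy
      simp only [Finset.mem_union, Finset.mem_erase] at hw ⊢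
      rcases hw with hw | hw
      · exact ⟨hw.1, hw.2.1, Or.inl hw.2.2⟩
      · exact ⟨fun h => hy' (h ▸ hw), fun h => hx' (h ▸ hw), Or.inr hw⟩
    · rintro t ⟨ht | ht, ht'⟩
      · exact Or.inl ⟨ht, ht'⟩
      · exact Or.inr ht

theorem exists_pair_of_mem (h : PairCover N F T) : ∀ {t : α}, t ∈ T → ∃ x ∈ F, ∃ y ∈ F, x ≠ y ∧
    t ∈ N x ∧ t ∈ N y ∧ PairCover N ((F.erase x).erase y) (T \ (N x ∩ N y)) := by
  induction h with
  | nil F => intro t ht; exact absurd ht (Set.notMem_empty t)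
  | @pair F T x y hx hy hxy h ih =>
    intro t ht
    by_cases hc : t ∈ N x ∩ N y
    · exact ⟨x, hx, y, hy, hxy, hc.1, hc.2, h⟩
    · obtain ⟨x', hx', y', hy', hxy', htx, hty, h'⟩ := ih ⟨ht, hc⟩
      simp only [Finset.mem_erase] at hx' hy'
      refine ⟨x', hx'.2.2, y', hy'.2.2, hxy', htx, hty, ?_⟩
      refine pair (x := x) (y := y) ?_ ?_ hxy (h'.mono' ?_ ?_)
      · simp only [Finset.mem_erase]; exact ⟨hy'.2.1.symm, hx'.2.1.symm, hx⟩
      · simp only [Finset.mem_erase]; exact ⟨hy'.1.symm, hx'.1.symm, hy⟩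
      · intro w; simp only [Finset.mem_erase]; tauto
      · intro w; simp only [Set.mem_sdiff]; tauto

/-- Any `z` in `F` can be set aside: either the cover does without `z`, or `z` is removed together
with its partner `w` and the points of `N z ∩ N w`. -/
theorem erase_or_exists_partner (h : PairCover N F T) : ∀ {z : ι}, z ∈ F →
    PairCover N (F.erase z) T ∨
      ∃ w ∈ F, w ≠ z ∧ PairCover N ((F.erase z).erase w) (T \ (N z ∩ N w)) := by
  induction h with
  | nil F => intro z _; exact Or.inl (nil _)
  | @pair F T x y hx hy hxy h ih =>
    intro z hz
    by_cases hzx : z = x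
    · subst hzx
      exact Or.inr ⟨y, hy, hxy.symm, h⟩
    by_cases hzy : z = y
    · subst hzy
      refine Or.inr ⟨x, hx, hxy, ?_⟩
      rwa [Finset.erase_right_comm, Set.inter_comm]
    rcases ih (z := z) (by simp [hzx, hzy, hz]) with h' | ⟨w, hw, hwz, h'⟩
    · left
      refine pair (x := x) (y := y) ?_ ?_ hxy (h'.mono' ?_ subset_rfl)
      · simp only [Finset.mem_erase]; exact ⟨Ne.symm hzx, hx⟩
      · simp only [Finset.mem_erase]; exact ⟨Ne.symm hzy, hy⟩
      · intro w; simp only [Finset.mem_erase]; tauto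
    · right
      simp only [Finset.mem_erase] at hw
      refine ⟨w, hw.2.2, hwz, pair (x := x) (y := y) ?_ ?_ hxy (h'.mono' ?_ ?_)⟩
      · simp only [Finset.mem_erase]; exact ⟨hw.2.1.symm, Ne.symm hzx, hx⟩
      · simp only [Finset.mem_erase]; exact ⟨hw.1.symm, Ne.symm hzy, hy⟩
      · intro w; simp only [Finset.mem_erase]; tauto
      · intro w; simp only [Set.mem_sdiff]; tauto

/-- The pairs of a `PairCover` as two enumerated families. -/
theorem exists_families (h : PairCover N F T) : ∃ (k : ℕ) (u v : Fin k → ι),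
    Function.Injective (Sum.elim u v) ∧ (∀ i, u i ∈ F ∧ v i ∈ F) ∧
      ∀ t ∈ T, ∃ i, t ∈ N (u i) ∧ t ∈ N (v i) := by
  induction h with
  | nil F =>
    refine ⟨0, Fin.elim0, Fin.elim0, ?_, fun i => i.elim0, fun t ht => absurd ht (by simp)⟩
    rintro (i | i) <;> exact i.elim0
  | @pair F T x y hx hy hxy h ih =>
    obtain ⟨k, u, v, hinj, hmem, hcov⟩ := ih
    simp only [Finset.mem_erase] at hmem
    rw [Sum.elim_injective] at hinj
    refine ⟨k + 1, Fin.cons x u, Fin.cons y v, ?_, ?_, ?_⟩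
    · rw [Sum.elim_injective, Fin.cons_injective_iff, Fin.cons_injective_iff]
      refine ⟨⟨?_, hinj.1⟩, ⟨?_, hinj.2.1⟩, ?_⟩
      · rintro ⟨i, hi⟩; exact (hmem i).1.2.1 hi
      · rintro ⟨i, hi⟩; exact (hmem i).2.1 hi
      · intro i j
        refine Fin.cases ?_ (fun i => ?_) i <;> refine Fin.cases ?_ (fun j => ?_) j
        · simpa using hxy
        · simpa using (hmem j).2.2.1.symm
        · simpa using (hmem i).1.1
        · simpa using hinj.2.2 i j
    · intro i
      refine Fin.cases ?_ (fun i => ?_) i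
      · simpa using ⟨hx, hy⟩
      · simpa using ⟨(hmem i).1.2.2, (hmem i).2.2.2⟩
    · intro t ht
      by_cases hc : t ∈ N x ∩ N y
      · exact ⟨0, by simpa using hc⟩
      · obtain ⟨i, hi⟩ := hcov t ⟨ht, hc⟩
        exact ⟨i.succ, by simpa using hi⟩

end PairCover

end PairCover

/-! ### Thin sets of points -/

section Thin

variable {ι α : Type*} [LinearOrder α]

/-- The points of `T` in the window `[u, v]` are thick for `F`: any two of them that are equal or
consecutive in `T` lie in two distinct elements of `F` whose traces on `T` are contained in the
window. -/
def Thick (N : ι → Set α) (F : Finset ι) (T : Finset α) (u v : α) : Prop :=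
  ∀ p ∈ T, ∀ p' ∈ T, u ≤ p → p ≤ p' → p' ≤ v → (∀ t ∈ T, ¬ (p < t ∧ t < p')) →
    ∃ x ∈ F, ∃ y ∈ F, x ≠ y ∧ (p ∈ N x ∧ p' ∈ N x ∧ ∀ t ∈ T, t ∈ N x → u ≤ t ∧ t ≤ v) ∧
      (p ∈ N y ∧ p' ∈ N y ∧ ∀ t ∈ T, t ∈ N y → u ≤ t ∧ t ≤ v)

/-- A nonempty set `T` of points is thin for `F` if it has no thick window. Thin sets are the
obstructions to pair covers: Staller can isolate a point of a thin set. -/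
def Thin (N : ι → Set α) (F : Finset ι) (T : Finset α) : Prop :=
  T.Nonempty ∧ ∀ u ∈ T, ∀ v ∈ T, u ≤ v → ¬ Thick N F T u v

theorem Thin.transfer {N N' : ι → Set α} {F F' : Finset ι} {T : Finset α} (h : Thin N F T)
    (hF : ∀ x ∈ F', ∀ t ∈ T, t ∈ N' x → x ∈ F ∧ ∀ t ∈ T, t ∈ N' x ↔ t ∈ N x) :
    Thin N' F' T := by
  refine ⟨h.1, fun u hu v hv huv hth => h.2 u hu v hv huv fun p hp p' hp' h1 h2 h3 h4 => ?_⟩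
  obtain ⟨x, hx, y, hy, hxy, hx', hy'⟩ := hth p hp p' hp' h1 h2 h3 h4
  have hX := hF x hx p hp hx'.1
  have hY := hF y hy p hp hy'.1
  exact ⟨x, hX.1, y, hY.1, hxy,
    ⟨(hX.2 p hp).1 hx'.1, (hX.2 p' hp').1 hx'.2.1, fun t ht h => hx'.2.2 t ht ((hX.2 t ht).2 h)⟩,
    ⟨(hY.2 p hp).1 hy'.1, (hY.2 p' hp').1 hy'.2.1, fun t ht h => hy'.2.2 t ht ((hY.2 t ht).2 h)⟩⟩

theorem thin_singleton {N : ι → Set α} {F : Finset ι} {m : α}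
    (h : ∀ x ∈ F, ∀ y ∈ F, m ∈ N x → m ∈ N y → x = y) : Thin N F {m} := by
  refine ⟨Finset.singleton_nonempty m, fun u hu v hv _ hth => ?_⟩
  obtain rfl := Finset.mem_singleton.1 hu
  obtain rfl := Finset.mem_singleton.1 hv
  obtain ⟨x, hx, y, hy, hxy, hx', hy'⟩ := hth v hu v hu le_rfl le_rfl le_rfl
    (fun t _ h => lt_asymm h.1 h.2)
  exact hxy (h x hx y hy hx'.1 hy'.1)

end Thin

/-! ### Contracting an initial segment -/

section Contraction

variable {ι α : Type*} [DecidableEq ι] [LinearOrder α]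

/-- The family of closed intervals `[a x, b x]`. -/
abbrev ivl (a b : ι → α) (x : ι) : Set α := Set.Icc (a x) (b x)

/-- The elements of `F` other than `P`, `P'` that lie to the left of the right end of `P'` and
avoid `m`, together with `P` and `P'`. -/
def leftPart (a b : ι → α) (F : Finset ι) (P P' : ι) (m : α) : Finset ι :=
  open Classical in F.filter fun x => x = P ∨ x = P' ∨ (b x ≤ b P' ∧ m ∉ ivl a b x)

theorem mem_leftPart {a b : ι → α} {F : Finset ι} {P P' : ι} {m : α} {x : ι} :
    x ∈ leftPart a b F P P' m ↔
      x ∈ F ∧ (x = P ∨ x = P' ∨ (b x ≤ b P' ∧ m ∉ ivl a b x)) := by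
  simp [leftPart]

/-- Let `q` be a point up to the right end of `P'` such that `leftPart` covers everything to the
left of `q`. Contract everything up to the right end of `P'` into the single point `q`, and replace
`leftPart` by a single element (named `P`) covering only `q`. A pair cover of this contraction
lifts to a pair cover of `T`. -/
theorem pairCover_of_contraction {a b : ι → α} {F : Finset ι} {P P' z : ι} {m q : α} {T : Set α}
    (hP' : P' ∈ F) (hz : z ∈ F) (hzP : z ≠ P) (hzP' : z ≠ P')
    (hmP' : m ∈ ivl a b P') (hmz : m ∈ ivl a b z) (hmT : ∀ t ∈ T, m ≤ t)
    (hmin : ∀ x ∈ F, x ≠ P → m ∈ ivl a b x → b P' ≤ b x) (hqs : q ≤ b P')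
    (hstar : ∀ x ∈ F, x ≠ P → x ≠ P' → m ∉ ivl a b x → a x ≤ q → b P' < b x → b z ≤ b x)
    (hH : PairCover (ivl a b) (leftPart a b F P P' m) (T ∩ Set.Iio q))
    (hF : PairCover (ivl (Function.update a P q) (Function.update b P q))
      (insert P (F \ leftPart a b F P P' m)) ({q} ∪ T ∩ Set.Ioi (b P'))) :
    PairCover (ivl a b) F T := by
  set H := leftPart a b F P P' m with hHdef
  set N := ivl a b
  set N' := ivl (Function.update a P q) (Function.update b P q) with hN'
  have hNN : ∀ x, x ≠ P → N' x = N x := fun x hx => by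
    simp [hN', N, ivl, Function.update_of_ne hx]
  have hNP : ∀ t, t ∈ N' P → t = q := fun t ht => by
    simpa [hN', ivl] using ht
  -- properties of the elements outside `leftPart`
  have hout : ∀ x ∈ F \ H, x ∈ F ∧ x ≠ P ∧ x ≠ P' ∧ b P' ≤ b x ∧ (m ∉ N x → b P' < b x) := by
    intro x hx
    rw [Finset.mem_sdiff, hHdef, mem_leftPart] at hx
    obtain ⟨hxF, hx⟩ := hx
    have hxP : x ≠ P := fun h => hx ⟨hxF, Or.inl h⟩
    have hxP' : x ≠ P' := fun h => hx ⟨hxF, Or.inr (Or.inl h)⟩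
    have hlt : m ∉ N x → b P' < b x := fun hm =>
      not_le.1 fun h => hx ⟨hxF, Or.inr (Or.inr ⟨h, hm⟩)⟩
    refine ⟨hxF, hxP, hxP', ?_, hlt⟩
    by_cases hm : m ∈ N x
    · exact hmin x hxF hxP hm
    · exact (hlt hm).le
  have hP'H : P' ∉ F \ H := fun h => (hout P' h).2.2.1 rfl
  -- the case that `q` is covered by the auxiliary element and `y`
  have key : ∀ y ∈ F \ H, q ∈ N y → PairCover N ((F \ H).erase y) (T ∩ Set.Ioi (b P')) →
      PairCover N F T := by
    intro y hy hqy hc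
    obtain ⟨hyF, hyP, hyP', hyb, hylt⟩ := hout y hy
    by_cases hm : m ∈ N y
    · refine PairCover.pair hP' hyF hyP'.symm (hc.mono' ?_ ?_)
      · intro w hw
        simp only [Finset.mem_erase] at hw ⊢
        exact ⟨hw.1, fun h => hP'H (h ▸ hw.2), (Finset.mem_sdiff.1 hw.2).1⟩
      · rintro t ⟨ht, htn⟩
        refine ⟨ht, not_le.1 fun hts => htn ⟨⟨hmP'.1.trans (hmT t ht), hts⟩,
          ⟨hm.1.trans (hmT t ht), hts.trans hyb⟩⟩⟩
    · have hbz := hstar y hyF hyP hyP' hm hqy.1 (hylt hm)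
      have hzH : z ∈ F \ H := by
        rw [Finset.mem_sdiff, hHdef, mem_leftPart]
        exact ⟨hz, fun h => h.2.elim hzP fun h => h.elim hzP' fun h => h.2 hmz⟩
      have hzy : z ≠ y := fun h => hm (h ▸ hmz)
      have hsub : ∀ t ∈ T, ¬ (t ∈ N P' ∩ N z) → b P' < t := fun t ht htn =>
        not_le.1 fun hts => htn ⟨⟨hmP'.1.trans (hmT t ht), hts⟩,
          ⟨hmz.1.trans (hmT t ht), hts.trans (hout z hzH).2.2.2.1⟩⟩
      refine PairCover.pair hP' hz hzP'.symm ?_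
      rcases hc.erase_or_exists_partner (Finset.mem_erase.2 ⟨hzy, hzH⟩) with hc | ⟨w, hw, hwz, hc⟩
      · refine hc.mono' ?_ ?_
        · intro w hw
          simp only [Finset.mem_erase] at hw ⊢
          exact ⟨hw.1, fun h => hP'H (h ▸ hw.2.2), (Finset.mem_sdiff.1 hw.2.2).1⟩
        · exact fun t ht => ⟨ht.1, hsub t ht.1 ht.2⟩
      · -- `y` reaches at least as far as `z`, so it takes over the role of `z` in its pair
        obtain ⟨hwy, hwH⟩ := Finset.mem_erase.1 hw
        refine PairCover.pair (x := y) (y := w) ?_ ?_ hwy.symm (hc.mono' ?_ ?_)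
        · simp only [Finset.mem_erase]
          exact ⟨hzy.symm, hyP', hyF⟩
        · simp only [Finset.mem_erase]
          exact ⟨hwz, (hout w hwH).2.2.1, (hout w hwH).1⟩
        · intro x hx
          simp only [Finset.mem_erase] at hx ⊢
          exact ⟨hx.1, hx.2.2.1, hx.2.1, fun h => hP'H (h ▸ hx.2.2.2),
            (Finset.mem_sdiff.1 hx.2.2.2).1⟩
        · rintro t ⟨⟨ht, htn⟩, htn'⟩
          have hst := hsub t ht htn
          refine ⟨⟨ht, hst⟩, fun h => htn' ⟨⟨?_, h.1.2.trans hbz⟩, h.2⟩⟩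
          exact hqy.1.trans (hqs.trans hst.le)
  have hPH : P ∉ F \ H := fun h => (hout P h).2.1 rfl
  obtain ⟨x, hx, y, hy, hxy, hqx, hqy, hc⟩ := hF.exists_pair_of_mem (t := q) (Or.inl rfl)
  have hred : ∀ y ∈ F \ H, ∀ C : Set α, C ⊆ N' P → PairCover N' ((F \ H).erase y)
      (({q} ∪ T ∩ Set.Ioi (b P')) \ C) → PairCover N ((F \ H).erase y) (T ∩ Set.Ioi (b P')) := by
    intro y _ C hC hc
    refine hc.mono subset_rfl ?_ ?_
    · exact fun t ht => ⟨Or.inr ht, fun h => absurd (hNP t (hC h))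
        (ne_of_gt (lt_of_le_of_lt hqs ht.2))⟩
    · intro w hw t _ h
      rwa [← hNN w (fun h => hPH (h ▸ Finset.mem_of_mem_erase hw))]
  rcases Finset.mem_insert.1 hx with rfl | hxH
  · have hyH := (Finset.mem_insert.1 hy).resolve_left hxy.symm
    rw [Finset.erase_insert hPH] at hc
    exact key y hyH (hNN y hxy.symm ▸ hqy) (hred y hyH _ Set.inter_subset_left hc)
  rcases Finset.mem_insert.1 hy with rfl | hyH
  · rw [Finset.erase_right_comm, Finset.erase_insert hPH] at hc
    exact key x hxH (hNN x hxy ▸ hqx) (hred x hxH _ Set.inter_subset_right hc)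
  -- `q` is covered by two elements outside `leftPart`
  have hxo := hout x hxH
  have hyo := hout y hyH
  have hc' : PairCover N (((F \ H).erase x).erase y) ((T ∩ Set.Ioi (b P')) \ (N x ∩ N y)) := by
    have hPm : P ∈ ((insert P (F \ H)).erase x).erase y := by
      simp [hxo.2.1.symm, hyo.2.1.symm]
    have hE : (((insert P (F \ H)).erase x).erase y).erase P = ((F \ H).erase x).erase y := by
      ext w
      simp only [Finset.mem_erase, Finset.mem_insert]
      constructor
      · tauto
      · exact fun h => ⟨fun hw => hPH (hw ▸ h.2.2), h.1, h.2.1, Or.inr h.2.2⟩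
    have hmono : ∀ w ∈ ((F \ H).erase x).erase y, ∀ t ∈ (T ∩ Set.Ioi (b P')) \ (N x ∩ N y),
        t ∈ N' w → t ∈ N w := by
      intro w hw t _ h
      simp only [Finset.mem_erase] at hw
      rwa [← hNN w (fun h => hPH (h ▸ hw.2.2))]
    rw [hNN x hxo.2.1, hNN y hyo.2.1] at hc
    rcases hc.erase_or_exists_partner hPm with hc | ⟨w, _, _, hc⟩
    · rw [hE] at hc
      exact hc.mono subset_rfl (fun t ht => ⟨Or.inr ht.1, ht.2⟩) hmono
    · rw [hE] at hc
      refine (hc.mono' (Finset.erase_subset _ _) ?_).mono subset_rfl subset_rfl hmono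
      exact fun t ht => ⟨⟨Or.inr ht.1, ht.2⟩, fun h => absurd (hNP t h.1)
        (ne_of_gt (lt_of_le_of_lt hqs ht.1.2))⟩
  have hdisj : Disjoint H (((F \ H).erase x).erase y) :=
    Finset.disjoint_sdiff.mono_right
      ((Finset.erase_subset _ _).trans (Finset.erase_subset _ _))
  have hHF : H ⊆ F := fun w hw => (mem_leftPart.1 hw).1
  refine PairCover.pair hxo.1 hyo.1 hxy ((hH.union hc' hdisj).mono' ?_ ?_)
  · intro w hw
    simp only [Finset.mem_union, Finset.mem_erase] at hw ⊢
    rcases hw with hw | hw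
    · refine ⟨fun h => ?_, fun h => ?_, hHF hw⟩
      · exact (Finset.mem_sdiff.1 hyH).2 (h ▸ hw)
      · exact (Finset.mem_sdiff.1 hxH).2 (h ▸ hw)
    · exact ⟨hw.1, hw.2.1, (Finset.mem_sdiff.1 hw.2.2).1⟩
  · rintro t ⟨ht, htn⟩
    rcases lt_or_ge t q with htq | htq
    · exact Or.inl ⟨ht, htq⟩
    · rw [hNN x hxo.2.1] at hqx
      rw [hNN y hyo.2.1] at hqy
      refine Or.inr ⟨⟨ht, not_le.1 fun hts => htn ⟨⟨hqx.1.trans htq, ?_⟩, ⟨hqy.1.trans htq, ?_⟩⟩⟩,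
        htn⟩
      · exact hts.trans hxo.2.2.2.1
      · exact hts.trans hyo.2.2.2.1

/-- A thin set of the contraction lifts to a thin set: the contracted point `q` is expanded to a set
`U` that is thin for the contracted elements `H`. -/
theorem Thin.expand {a b : ι → α} {F H : Finset ι} {P : ι} {q s : α} {U T : Finset α}
    (hP : P ∈ H) (hHs : ∀ x ∈ H, b x ≤ s) (hFs : ∀ x ∈ F \ H, s ≤ b x)
    (hqU : q ∈ U) (hUq : ∀ t ∈ U, t ≤ q) (hqs : q ≤ s) (hqT : q ∈ T)
    (hT : ∀ t ∈ T, t = q ∨ s < t) (hU : Thin (ivl a b) H U)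
    (hthin : Thin (ivl (Function.update a P q) (Function.update b P q)) (insert P (F \ H)) T) :
    Thin (ivl a b) F (U ∪ T) := by
  set N := ivl a b
  set N' := ivl (Function.update a P q) (Function.update b P q) with hN'
  have hNN : ∀ x, x ≠ P → N' x = N x := fun x hx => by
    simp [hN', N, ivl, Function.update_of_ne hx]
  have hNP : ∀ t, t ∈ N' P ↔ t = q := fun t => by
    simp [hN', ivl]
  have hFP : ∀ x ∈ F \ H, x ≠ P := fun x hx h => (Finset.mem_sdiff.1 hx).2 (h ▸ hP)
  have hTq : ∀ t ∈ T, q ≤ t := fun t ht => (hT t ht).elim (fun h => h.ge) fun h => hqs.trans h.le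
  refine ⟨⟨q, Finset.mem_union_left _ hqU⟩, fun u hu v hv huv hth => ?_⟩
  rcases le_or_gt v q with hvq | hqv
  · have hmemU : ∀ t ∈ U ∪ T, t ≤ q → t ∈ U := fun t ht htq => by
      rcases Finset.mem_union.1 ht with h | h
      · exact h
      · rwa [le_antisymm htq (hTq t h)]
    -- an element outside `H` with trace in the window would have trace `{q}` on `T`
    have hin : ∀ x ∈ F, ∀ p ∈ U ∪ T, p ≤ v → p ∈ N x → (∀ t ∈ U ∪ T, t ∈ N x → u ≤ t ∧ t ≤ v) →
        x ∈ H := by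
      intro x hx p hp hpv hpx hxt
      by_contra hxH
      have hxFH : x ∈ F \ H := Finset.mem_sdiff.2 ⟨hx, hxH⟩
      have hqx : q ∈ N x := ⟨hpx.1.trans (hpv.trans hvq), hqs.trans (hFs x hxFH)⟩
      have hqv' : q ≤ v := (hxt q (Finset.mem_union_left _ hqU) hqx).2
      refine hthin.2 q hqT q hqT le_rfl fun p hp p' hp' h1 h2 h3 _ => ?_
      obtain rfl : p = q := le_antisymm (h2.trans h3) h1
      obtain rfl : p' = p := le_antisymm h3 h2
      refine ⟨x, Finset.mem_insert_of_mem hxFH, P, Finset.mem_insert_self _ _, hFP x hxFH, ?_, ?_⟩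
      · rw [hNN x (hFP x hxFH)]
        exact ⟨hqx, hqx, fun t ht htx =>
          ⟨hTq t ht, (hxt t (Finset.mem_union_right _ ht) htx).2.trans hvq⟩⟩
      · simp only [hNP]
        exact ⟨trivial, trivial, fun t _ h => ⟨h.ge, h.le⟩⟩
    refine hU.2 u (hmemU u hu (huv.trans hvq)) v (hmemU v hv hvq) huv
      fun p hp p' hp' h1 h2 h3 h4 => ?_
    obtain ⟨x, hx, y, hy, hxy, hx', hy'⟩ := hth p (Finset.mem_union_left _ hp) p'
      (Finset.mem_union_left _ hp') h1 h2 h3 (fun t ht h =>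
        h4 t (hmemU t ht (h.2.le.trans (h3.trans hvq))) h)
    have hpv := h2.trans h3
    refine ⟨x, hin x hx p (Finset.mem_union_left _ hp) hpv hx'.1 hx'.2.2,
      y, hin y hy p (Finset.mem_union_left _ hp) hpv hy'.1 hy'.2.2, hxy,
      ⟨hx'.1, hx'.2.1, fun t ht => hx'.2.2 t (Finset.mem_union_left _ ht)⟩,
      ⟨hy'.1, hy'.2.1, fun t ht => hy'.2.2 t (Finset.mem_union_left _ ht)⟩⟩
  · have hvT : v ∈ T := (Finset.mem_union.1 hv).resolve_left fun h => absurd (hUq v h) (not_le.2 hqv)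
    have hmemT : ∀ t ∈ U ∪ T, q ≤ t → t ∈ T := fun t ht htq => by
      rcases Finset.mem_union.1 ht with h | h
      · rwa [le_antisymm (hUq t h) htq]
      · exact h
    have hmaxT : max u q ∈ T := by
      rcases le_total u q with h | h
      · rwa [max_eq_right h]
      · rw [max_eq_left h]; exact hmemT u hu h
    have hmaxv : max u q ≤ v := max_le huv hqv.le
    refine hthin.2 _ hmaxT v hvT hmaxv ?_
    have hconv : ∀ x ∈ F, ∀ p', s < p' → p' ∈ N x →
        (∀ t ∈ U ∪ T, t ∈ N x → u ≤ t ∧ t ≤ v) →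
        x ∈ insert P (F \ H) ∧ N' x = N x ∧ ∀ t ∈ T, t ∈ N x → max u q ≤ t ∧ t ≤ v := by
      intro x hx p' hp' hpx hxt
      have hxFH : x ∈ F \ H := Finset.mem_sdiff.2 ⟨hx, fun h =>
        absurd (hHs x h) (not_le.2 (hp'.trans_le hpx.2))⟩
      refine ⟨Finset.mem_insert_of_mem hxFH, hNN x (hFP x hxFH), fun t ht htx => ?_⟩
      have := hxt t (Finset.mem_union_right _ ht) htx
      exact ⟨max_le this.1 (hTq t ht), this.2⟩
    have main : ∀ p ∈ T, ∀ p' ∈ T, max u q ≤ p → p ≤ p' → p' ≤ v →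
        (∀ t ∈ T, ¬ (p < t ∧ t < p')) → s < p' → ∃ x ∈ insert P (F \ H),
          ∃ y ∈ insert P (F \ H), x ≠ y ∧
          (p ∈ N' x ∧ p' ∈ N' x ∧ ∀ t ∈ T, t ∈ N' x → max u q ≤ t ∧ t ≤ v) ∧
          (p ∈ N' y ∧ p' ∈ N' y ∧ ∀ t ∈ T, t ∈ N' y → max u q ≤ t ∧ t ≤ v) := by
      intro p hp p' hp' h1 h2 h3 h4 hsp'
      obtain ⟨x, hx, y, hy, hxy, hx', hy'⟩ := hth p (Finset.mem_union_right _ hp) p'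
        (Finset.mem_union_right _ hp') ((le_max_left _ _).trans h1) h2 h3 (fun t ht h =>
          h4 t (hmemT t ht (((le_max_right _ _).trans h1).trans h.1.le)) h)
      obtain ⟨hxm, hxN, hxt⟩ := hconv x hx p' hsp' hx'.2.1 hx'.2.2
      obtain ⟨hym, hyN, hyt⟩ := hconv y hy p' hsp' hy'.2.1 hy'.2.2
      refine ⟨x, hxm, y, hym, hxy, ?_, ?_⟩
      · rw [hxN]; exact ⟨hx'.1, hx'.2.1, hxt⟩
      · rw [hyN]; exact ⟨hy'.1, hy'.2.1, hyt⟩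
    intro p hp p' hp' h1 h2 h3 h4
    rcases hT p' hp' with rfl | hsp'
    · -- at the contracted point itself, use the two elements that contain it and the next point
      have hpp : p = p' := le_antisymm h2 ((le_max_right _ _).trans h1)
      subst hpp
      have hne : (T.filter (p < ·)).Nonempty := ⟨v, Finset.mem_filter.2 ⟨hvT, hqv⟩⟩
      have hmem := Finset.mem_filter.1 (Finset.min'_mem _ hne)
      set p₁ := (T.filter (p < ·)).min' hne
      obtain ⟨x, hx, y, hy, hxy, hx', hy'⟩ := main p hp p₁ hmem.1 h1 hmem.2.le
        (Finset.min'_le _ _ (Finset.mem_filter.2 ⟨hvT, hqv⟩))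
        (fun t ht h => absurd (Finset.min'_le _ _ (Finset.mem_filter.2 ⟨ht, h.1⟩)) (not_le.2 h.2))
        ((hT p₁ hmem.1).resolve_left hmem.2.ne')
      exact ⟨x, hx, y, hy, hxy, ⟨hx'.1, hx'.1, hx'.2.2⟩, ⟨hy'.1, hy'.1, hy'.2.2⟩⟩
    · exact main p hp p' hp' h1 h2 h3 h4 hsp'

end Contraction

/-! ### The duality of pair covers and thin sets -/

section Duality

variable {ι α : Type*} [DecidableEq ι] [LinearOrder α]

/-- Let `P'` be the element other than `P` at `m` that ends first, and let `T₂`, to the right of `P`,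
be thin for the elements other than `P`, `P'`. If neither `T₂` nor `insert m T₂` is thin for `F`,
then `insert m T₂` has a thick window, and it starts at `m`. As the corresponding window of `T₂` is
not thick without `P` and `P'`, it has a place, beginning at some `p`, whose thickness relies on
`P'` and on the next element `z` at `m`. Cutting there leaves a set that is thin for `leftPart`, and
an element avoiding `m` that leads from `p` or earlier beyond `P'` ends no earlier than `z`. -/
theorem Thin.exists_leftPart {a b : ι → α} {F : Finset ι} {P P' : ι} {m : α} {T₂ : Finset α}
    (hP' : P' ∈ F) (hmP' : m ∈ ivl a b P') (hmP : m ∈ ivl a b P)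
    (hmin : ∀ x ∈ F, x ≠ P → m ∈ ivl a b x → b P' ≤ b x)
    (hm : ∀ t ∈ T₂, m < t) (hP : ∀ t ∈ T₂, b P < t)
    (hT₂ : Thin (ivl a b) ((F.erase P).erase P') T₂) :
    Thin (ivl a b) F T₂ ∨ Thin (ivl a b) F (insert m T₂) ∨
      ∃ z ∈ F, z ≠ P ∧ z ≠ P' ∧ m ∈ ivl a b z ∧ ∃ p ∈ T₂, p ≤ b P' ∧
        Thin (ivl a b) (leftPart a b F P P' m) (insert m (T₂.filter (· ≤ p))) ∧
        ∀ x ∈ F, x ≠ P → x ≠ P' → m ∉ ivl a b x → a x ≤ p → b P' < b x → b z ≤ b x := by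
  classical
  set N := ivl a b with hN
  have hcT := Finset.min'_mem T₂ hT₂.1
  have hcmin := fun t ht => Finset.min'_le T₂ t ht
  set c := T₂.min' hT₂.1
  have hmc := hm c hcT
  have hmem : ∀ x ∈ F, m ∉ N x → x ∈ (F.erase P).erase P' := fun x hx hmx =>
    Finset.mem_erase.2 ⟨fun h => hmx (h ▸ hmP'), Finset.mem_erase.2 ⟨fun h => hmx (h ▸ hmP), hx⟩⟩
  have hnotP : ∀ x, ∀ t ∈ T₂, t ∈ N x → x ≠ P := fun x t ht htx h =>
    absurd (h ▸ htx.2) (not_le.2 (hP t ht))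
  by_cases hcs : b P' < c
  · left
    refine hT₂.transfer fun x hx t ht htx => ⟨?_, fun _ _ => Iff.rfl⟩
    refine Finset.mem_erase.2 ⟨fun h => ?_, Finset.mem_erase.2 ⟨hnotP x t ht htx, hx⟩⟩
    exact absurd (h ▸ htx.2) (not_le.2 (hcs.trans_le (hcmin t ht)))
  rw [not_lt] at hcs
  by_cases hthin : Thin N F (insert m T₂)
  · exact Or.inr (Or.inl hthin)
  right; right
  have hex : ∃ u ∈ insert m T₂, ∃ v ∈ insert m T₂, u ≤ v ∧ Thick N F (insert m T₂) u v := by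
    by_contra hcon
    push Not at hcon
    exact hthin ⟨⟨m, Finset.mem_insert_self _ _⟩, hcon⟩
  obtain ⟨u, hu, v, hv, huv, hth⟩ := hex
  -- a thick window has to start at `m`
  obtain rfl : u = m := by
    by_contra hum
    have huT := (Finset.mem_insert.1 hu).resolve_left hum
    have hvT := (Finset.mem_insert.1 hv).resolve_left ((hm u huT).trans_le huv).ne'
    refine hT₂.2 u huT v hvT huv fun p hp p' hp' h1 h2 h3 h4 => ?_
    obtain ⟨x, hx, y, hy, hxy, hx', hy'⟩ := hth p (Finset.mem_insert_of_mem hp) p'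
      (Finset.mem_insert_of_mem hp') h1 h2 h3 (fun t ht h => by
        rcases Finset.mem_insert.1 ht with rfl | ht
        · exact lt_asymm h.1 (hm p hp)
        · exact h4 t ht h)
    have hout : ∀ x, (∀ t ∈ insert m T₂, t ∈ N x → u ≤ t ∧ t ≤ v) → m ∉ N x := fun x hx hmx =>
      absurd (hx m (Finset.mem_insert_self _ _) hmx).1 (not_le.2 (hm u huT))
    exact ⟨x, hmem x hx (hout x hx'.2.2), y, hmem y hy (hout y hy'.2.2), hxy,
      ⟨hx'.1, hx'.2.1, fun t ht => hx'.2.2 t (Finset.mem_insert_of_mem ht)⟩,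
      ⟨hy'.1, hy'.2.1, fun t ht => hy'.2.2 t (Finset.mem_insert_of_mem ht)⟩⟩
  have hvT : v ∈ T₂ := by
    refine (Finset.mem_insert.1 hv).resolve_left ?_
    rintro rfl
    obtain ⟨x, hx, y, hy, hxy, hx', hy'⟩ := hth v hv v hv le_rfl le_rfl le_rfl
      (fun t _ h => lt_asymm h.1 h.2)
    have : ∀ x ∈ F, v ∈ N x → (∀ t ∈ insert v T₂, t ∈ N x → v ≤ t ∧ t ≤ v) → x = P := by
      intro x hx hmx hxt
      by_contra hxP
      refine absurd (hxt c (Finset.mem_insert_of_mem hcT) ⟨hmx.1.trans hmc.le, ?_⟩).2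
        (not_le.2 hmc)
      exact hcs.trans (hmin x hx hxP hmx)
    exact hxy ((this x hx hx'.1 hx'.2.2).trans (this y hy hy'.1 hy'.2.2).symm)
  obtain ⟨w, hwF, hwP, hwP', hmw, hwt⟩ : ∃ w ∈ F, w ≠ P ∧ w ≠ P' ∧ u ∈ N w ∧
      ∀ t ∈ T₂, t ∈ N w → t ≤ v := by
    obtain ⟨x, hx, y, hy, hxy, hx', hy'⟩ := hth u hu c (Finset.mem_insert_of_mem hcT) le_rfl
      hmc.le (hcmin v hvT) (fun t ht h => by
        rcases Finset.mem_insert.1 ht with rfl | ht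
        · exact lt_irrefl _ h.1
        · exact absurd (hcmin t ht) (not_le.2 h.2))
    by_cases hxP' : x = P'
    · exact ⟨y, hy, hnotP y c hcT hy'.2.1, fun h => hxy (hxP'.trans h.symm), hy'.1,
        fun t ht h => (hy'.2.2 t (Finset.mem_insert_of_mem ht) h).2⟩
    · exact ⟨x, hx, hnotP x c hcT hx'.2.1, hxP', hx'.1,
        fun t ht h => (hx'.2.2 t (Finset.mem_insert_of_mem ht) h).2⟩
  obtain ⟨z, hz, hzmin⟩ := Finset.exists_min_image
    (F.filter fun x => x ≠ P ∧ x ≠ P' ∧ u ∈ N x) b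
    ⟨w, Finset.mem_filter.2 ⟨hwF, hwP, hwP', hmw⟩⟩
  obtain ⟨hzF, hzP, hzP', hmz⟩ := Finset.mem_filter.1 hz
  have hbz := hzmin w (Finset.mem_filter.2 ⟨hwF, hwP, hwP', hmw⟩)
  have hzv : ∀ t ∈ T₂, t ≤ b z → t ≤ v := fun t ht htz =>
    hwt t ht ⟨hmw.1.trans (hm t ht).le, htz.trans hbz⟩
  have hsz := hmin z hzF hzP hmz
  -- the thinness of `T₂` gives a place in the window that only `P'` and `z` make thick
  have hnth := hT₂.2 c hcT v hvT (hcmin v hvT)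
  unfold Thick at hnth
  push Not at hnth
  obtain ⟨p, hp, p', hp', hcp, hpp', hpv, hcons, huniq⟩ := hnth
  have hcons' : ∀ t ∈ T₂, p < t → p' ≤ t := fun t ht h => hcons t ht h
  have hps : p' ≤ b P' := by
    obtain ⟨x, hx, y, hy, hxy, hx', hy'⟩ := hth p (Finset.mem_insert_of_mem hp) p'
      (Finset.mem_insert_of_mem hp') (hm p hp).le hpp' hpv (fun t ht h => by
        rcases Finset.mem_insert.1 ht with rfl | ht
        · exact lt_asymm h.1 (hm p hp)
        · exact absurd (hcons' t ht h.1) (not_le.2 h.2))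
    by_cases hxP' : x = P'
    · exact hxP' ▸ hx'.2.1.2
    by_cases hyP' : y = P'
    · exact hyP' ▸ hy'.2.1.2
    obtain ⟨t, ht, hty, htn⟩ := huniq x
      (Finset.mem_erase.2 ⟨hxP', Finset.mem_erase.2 ⟨hnotP x p hp hx'.1, hx⟩⟩) y
      (Finset.mem_erase.2 ⟨hyP', Finset.mem_erase.2 ⟨hnotP y p hp hy'.1, hy⟩⟩) hxy
      ⟨hx'.1, hx'.2.1, fun t ht h =>
        ⟨hcmin t ht, (hx'.2.2 t (Finset.mem_insert_of_mem ht) h).2⟩⟩ hy'.1 hy'.2.1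
    exact absurd (hy'.2.2 t (Finset.mem_insert_of_mem ht) hty).2 (not_le.2 (htn (hcmin t ht)))
  have hkey : ∀ x ∈ F, u ∉ N x → p ∈ N x → p' ∈ N x → b z < b x := by
    intro x hx hmx hpx hpx'
    by_contra hbx
    rw [not_lt] at hbx
    have hzx : z ≠ x := fun h => hmx (h ▸ hmz)
    obtain ⟨t, ht, htx, htn⟩ := huniq z
      (Finset.mem_erase.2 ⟨hzP', Finset.mem_erase.2 ⟨hzP, hzF⟩⟩) x (hmem x hx hmx) hzx
      ⟨⟨hmz.1.trans (hm p hp).le, (hpp'.trans hps).trans hsz⟩,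
        ⟨hmz.1.trans (hm p' hp').le, hps.trans hsz⟩,
        fun t ht h => ⟨hcmin t ht, hzv t ht h.2⟩⟩ hpx hpx'
    exact absurd (hzv t ht (htx.2.trans hbx)) (not_le.2 (htn (hcmin t ht)))
  refine ⟨z, hzF, hzP, hzP', hmz, p, hp, hpp'.trans hps, ?_, ?_⟩
  · have hmemL : ∀ x ∈ leftPart a b F P P' u, u ∈ N x → x ≠ P → x = P' := by
      intro x hx hmx hxP
      rcases (mem_leftPart.1 hx).2 with h | h | h
      · exact absurd h hxP
      · exact h
      · exact absurd hmx h.2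
    have hcU : c ∈ insert u (T₂.filter (· ≤ p)) :=
      Finset.mem_insert_of_mem (Finset.mem_filter.2 ⟨hcT, hcp⟩)
    refine ⟨⟨u, Finset.mem_insert_self _ _⟩, fun u' hu' v' hv' huv' hth' => ?_⟩
    rcases Finset.mem_insert.1 hu' with rfl | hu'
    · rcases Finset.mem_insert.1 hv' with rfl | hv'
      · obtain ⟨x, hx, y, hy, hxy, hx', hy'⟩ := hth' v' hu' v' hu' le_rfl le_rfl le_rfl
          (fun t _ h => lt_asymm h.1 h.2)
        have : ∀ x ∈ leftPart a b F P P' v', v' ∈ N x →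
            (∀ t ∈ insert v' (T₂.filter (· ≤ p)), t ∈ N x → v' ≤ t ∧ t ≤ v') → x = P := by
          intro x hx hmx hxt
          by_contra hxP
          obtain rfl := hmemL x hx hmx hxP
          exact absurd (hxt c hcU ⟨hmx.1.trans hmc.le, hcs⟩).2 (not_le.2 hmc)
        exact hxy ((this x hx hx'.1 hx'.2.2).trans (this y hy hy'.1 hy'.2.2).symm)
      · have hv'' := (Finset.mem_filter.1 hv').1
        obtain ⟨x, hx, y, hy, hxy, hx', hy'⟩ := hth' u' hu' c hcU le_rfl hmc.le
          (hcmin v' hv'') (fun t ht h => by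
            rcases Finset.mem_insert.1 ht with rfl | ht
            · exact lt_irrefl _ h.1
            · exact absurd (hcmin t (Finset.mem_filter.1 ht).1) (not_le.2 h.2))
        exact hxy ((hmemL x hx hx'.1 (hnotP x c hcT hx'.2.1)).trans
          (hmemL y hy hy'.1 (hnotP y c hcT hy'.2.1)).symm)
    · obtain ⟨huT, hup⟩ := Finset.mem_filter.1 hu'
      have hmu := hm u' huT
      have hv'' := (Finset.mem_insert.1 hv').resolve_left (hmu.trans_le huv').ne'
      obtain ⟨hvT', hvp'⟩ := Finset.mem_filter.1 hv''
      refine hT₂.2 u' huT v' hvT' huv' fun p₁ hp₁ p₁' hp₁' h1 h2 h3 h4 => ?_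
      have hp₁p : p₁' ≤ p := h3.trans hvp'
      obtain ⟨x, hx, y, hy, hxy, hx', hy'⟩ := hth' p₁
        (Finset.mem_insert_of_mem (Finset.mem_filter.2 ⟨hp₁, h2.trans hp₁p⟩)) p₁'
        (Finset.mem_insert_of_mem (Finset.mem_filter.2 ⟨hp₁', hp₁p⟩)) h1 h2 h3
        (fun t ht h => by
          rcases Finset.mem_insert.1 ht with rfl | ht
          · exact lt_asymm h.1 (hm p₁ hp₁)
          · exact h4 t (Finset.mem_filter.1 ht).1 h)
      have conv : ∀ x ∈ leftPart a b F P P' u, p₁ ∈ N x →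
          (∀ t ∈ insert u (T₂.filter (· ≤ p)), t ∈ N x → u' ≤ t ∧ t ≤ v') →
          x ∈ (F.erase P).erase P' ∧ ∀ t ∈ T₂, t ∈ N x → u' ≤ t ∧ t ≤ v' := by
        intro x hx hp₁x hxt
        obtain ⟨hxF, hxL⟩ := mem_leftPart.1 hx
        have hmx : u ∉ N x := fun h =>
          absurd (hxt u (Finset.mem_insert_self _ _) h).1 (not_le.2 hmu)
        have hbx : b x ≤ b P' := by
          rcases hxL with h | h | h
          · exact absurd (h ▸ hmP) hmx
          · exact h ▸ le_rfl
          · exact h.1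
        refine ⟨hmem x hxF hmx, fun t ht htx => ?_⟩
        rcases le_or_gt t p with htp | htp
        · exact hxt t (Finset.mem_insert_of_mem (Finset.mem_filter.2 ⟨ht, htp⟩)) htx
        · have hax : a x ≤ p := hp₁x.1.trans (h2.trans hp₁p)
          exact absurd (hkey x hxF hmx ⟨hax, htp.le.trans htx.2⟩
            ⟨hax.trans hpp', (hcons' t ht htp).trans htx.2⟩) (not_lt.2 (hbx.trans hsz))
      obtain ⟨hxm, hxt⟩ := conv x hx hx'.1 hx'.2.2
      obtain ⟨hym, hyt⟩ := conv y hy hy'.1 hy'.2.2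
      exact ⟨x, hxm, y, hym, hxy, ⟨hx'.1, hx'.2.1, hxt⟩, ⟨hy'.1, hy'.2.1, hyt⟩⟩
  · intro x hx _ _ hmx hax hbx
    exact (hkey x hx hmx ⟨hax, hpp'.trans (hps.trans hbx.le)⟩
      ⟨hax.trans hpp', hps.trans hbx.le⟩).le

/-- The duality of pair covers and thin sets, by induction on `F`. At the least point `m` of `T` let
`P`, `P'` be the two elements that end first. If they form a pair, the points beyond `P` are left to
the other elements, and the induction hypothesis yields a cover or a thin set `T₂` for those. In the
case where `T₂` gives no thin set for `F` (`Thin.exists_leftPart`), the elements of `leftPart` are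
contracted, and the induction hypothesis for the contraction is lifted by
`pairCover_of_contraction` and `Thin.expand`. -/
theorem pairCover_or_exists_thin (F : Finset ι) : ∀ (a b : ι → α) (T : Finset α),
    PairCover (ivl a b) F (T : Set α) ∨ ∃ U ⊆ T, Thin (ivl a b) F U := by
  classical
  induction F using Finset.strongInduction with
  | H F ih =>
  intro a b T
  rcases T.eq_empty_or_nonempty with rfl | hTne
  · left
    rw [Finset.coe_empty]
    exact PairCover.nil F
  have hmT := Finset.min'_mem T hTne
  have hmle := fun t ht => Finset.min'_le T t ht
  set m := T.min' hTne
  by_cases hone : ∀ x ∈ F, ∀ y ∈ F, m ∈ ivl a b x → m ∈ ivl a b y → x = y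
  · exact Or.inr ⟨{m}, Finset.singleton_subset_iff.2 hmT, thin_singleton hone⟩
  push Not at hone
  obtain ⟨x₀, hx₀, y₀, hy₀, hmx₀, hmy₀, hxy₀⟩ := hone
  -- the two elements at `m` that end first
  obtain ⟨P, hPm, hPmin⟩ := Finset.exists_min_image (F.filter fun x => m ∈ ivl a b x) b
    ⟨x₀, Finset.mem_filter.2 ⟨hx₀, hmx₀⟩⟩
  obtain ⟨hPF, hmP⟩ := Finset.mem_filter.1 hPm
  obtain ⟨P', hPm', hPmin'⟩ := Finset.exists_min_image
    (F.filter fun x => x ≠ P ∧ m ∈ ivl a b x) b (by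
      by_cases h : x₀ = P
      · exact ⟨y₀, Finset.mem_filter.2 ⟨hy₀, fun h' => hxy₀ (h.trans h'.symm), hmy₀⟩⟩
      · exact ⟨x₀, Finset.mem_filter.2 ⟨hx₀, h, hmx₀⟩⟩)
  obtain ⟨hPF', hPP, hmP'⟩ := Finset.mem_filter.1 hPm'
  have hmin : ∀ x ∈ F, x ≠ P → m ∈ ivl a b x → b P' ≤ b x := fun x hx hxP hmx =>
    hPmin' x (Finset.mem_filter.2 ⟨hx, hxP, hmx⟩)
  have hbPP : b P ≤ b P' := hPmin P' (Finset.mem_filter.2 ⟨hPF', hmP'⟩)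
  have hF₂ : (F.erase P).erase P' ⊂ F :=
    lt_of_le_of_lt (Finset.erase_subset _ _) (Finset.erase_ssubset hPF)
  rcases ih _ hF₂ a b (T.filter (b P < ·)) with hc | ⟨T₂, hT₂T, hT₂⟩
  · left
    refine PairCover.pair hPF hPF' hPP.symm (hc.mono' subset_rfl ?_)
    rintro t ⟨ht, htn⟩
    have ht' := hmle t ht
    refine Finset.mem_coe.2 (Finset.mem_filter.2 ⟨ht, not_le.1 fun h => htn ?_⟩)
    exact ⟨⟨hmP.1.trans ht', h⟩, ⟨hmP'.1.trans ht', h.trans hbPP⟩⟩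
  have hT₂P : ∀ t ∈ T₂, b P < t := fun t ht => (Finset.mem_filter.1 (hT₂T ht)).2
  have hT₂' : T₂ ⊆ T := hT₂T.trans (Finset.filter_subset _ _)
  rcases hT₂.exists_leftPart hPF' hmP' hmP hmin (fun t ht => hmP.2.trans_lt (hT₂P t ht)) hT₂P with
    h | h | ⟨z, hzF, hzP, hzP', hmz, p, hp, hps, hU₀, hstar⟩
  · exact Or.inr ⟨T₂, hT₂', h⟩
  · exact Or.inr ⟨_, Finset.insert_subset hmT hT₂', h⟩
  set H := leftPart a b F P P' m with hHdef
  have hHF : H ⊆ F := fun x hx => (mem_leftPart.1 hx).1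
  have hPH : P ∈ H := mem_leftPart.2 ⟨hPF, Or.inl rfl⟩
  have hPH' : P' ∈ H := mem_leftPart.2 ⟨hPF', Or.inr (Or.inl rfl)⟩
  have hzH : z ∉ H := fun h => (mem_leftPart.1 h).2.elim hzP fun h => h.elim hzP' fun h => h.2 hmz
  have hHs : ∀ x ∈ H, b x ≤ b P' := by
    intro x hx
    rcases (mem_leftPart.1 hx).2 with rfl | rfl | h
    · exact hbPP
    · exact le_rfl
    · exact h.1
  have hFs : ∀ x ∈ F \ H, b P' ≤ b x := by
    intro x hx
    obtain ⟨hxF, hxH⟩ := Finset.mem_sdiff.1 hx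
    by_cases hmx : m ∈ ivl a b x
    · exact hmin x hxF (fun h => hxH (h ▸ hPH)) hmx
    · exact (not_le.1 fun h => hxH (mem_leftPart.2 ⟨hxF, Or.inr (Or.inr ⟨h, hmx⟩)⟩)).le
  -- choose a set `U` that is thin for `H` and whose last point `q` is as small as possible
  have hSne : (T.filter fun q => q ≤ p ∧ ∃ U ⊆ T, q ∈ U ∧ (∀ t ∈ U, t ≤ q) ∧
      Thin (ivl a b) H U).Nonempty := by
    refine ⟨p, Finset.mem_filter.2 ⟨hT₂' hp, le_rfl, _, ?_, ?_, ?_, hU₀⟩⟩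
    · exact Finset.insert_subset hmT ((Finset.filter_subset _ _).trans hT₂')
    · exact Finset.mem_insert_of_mem (Finset.mem_filter.2 ⟨hp, le_rfl⟩)
    · intro t ht
      rcases Finset.mem_insert.1 ht with rfl | ht
      · exact hmle p (hT₂' hp)
      · exact (Finset.mem_filter.1 ht).2
  have hqS := Finset.min'_mem _ hSne
  have hqmin := fun t ht => Finset.min'_le (T.filter fun q => q ≤ p ∧
    ∃ U ⊆ T, q ∈ U ∧ (∀ t ∈ U, t ≤ q) ∧ Thin (ivl a b) H U) t ht
  set q := Finset.min' _ hSne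
  obtain ⟨hqT, hqp, U, hUT, hqU, hUq, hU⟩ := Finset.mem_filter.1 hqS
  have hHc : PairCover (ivl a b) H ((T : Set α) ∩ Set.Iio q) := by
    have hss : H ⊂ F := (Finset.ssubset_iff_of_subset hHF).2 ⟨z, hzF, hzH⟩
    rcases ih H hss a b (T.filter (· < q)) with h | ⟨U', hU'T, hU'⟩
    · refine h.mono' subset_rfl fun t ht => ?_
      exact Finset.mem_coe.2 (Finset.mem_filter.2 ⟨ht.1, ht.2⟩)
    · exfalso
      have hm' := Finset.max'_mem U' hU'.1
      have hlt := Finset.mem_filter.1 (hU'T hm')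
      refine absurd (hqmin _ (Finset.mem_filter.2 ⟨hlt.1, hlt.2.le.trans hqp, U',
        hU'T.trans (Finset.filter_subset _ _), hm', fun t ht => Finset.le_max' U' t ht, hU'⟩))
        (not_le.2 hlt.2)
  have hFss : insert P (F \ H) ⊂ F := by
    refine (Finset.ssubset_iff_of_subset ?_).2 ⟨P', hPF', fun h => ?_⟩
    · exact Finset.insert_subset hPF Finset.sdiff_subset
    · rcases Finset.mem_insert.1 h with h | h
      · exact hPP h
      · exact (Finset.mem_sdiff.1 h).2 hPH'
  have hqs := hqp.trans hps
  rcases ih _ hFss (Function.update a P q) (Function.update b P q)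
    (insert q (T.filter (b P' < ·))) with hc | ⟨T', hT'T, hT'⟩
  · left
    refine pairCover_of_contraction hPF' hzF hzP hzP' hmP' hmz hmle hmin hqs
      (fun x h1 h2 h3 h4 h5 h6 => hstar x h1 h2 h3 h4 (h5.trans hqp) h6) hHc
      (hc.mono' subset_rfl ?_)
    rintro t (rfl | ht)
    · exact Finset.mem_coe.2 (Finset.mem_insert_self _ _)
    · exact Finset.mem_coe.2 (Finset.mem_insert_of_mem (Finset.mem_filter.2 ht))
  · right
    have hT'' : ∀ t ∈ T', t = q ∨ b P' < t := fun t ht =>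
      (Finset.mem_insert.1 (hT'T ht)).imp_right fun h => (Finset.mem_filter.1 h).2
    have hT'sub : T' ⊆ T := hT'T.trans (Finset.insert_subset hqT (Finset.filter_subset _ _))
    by_cases hqT' : q ∈ T'
    · exact ⟨U ∪ T', Finset.union_subset hUT hT'sub,
        Thin.expand hPH hHs hFs hqU hUq hqs hqT' hT'' hU hT'⟩
    · refine ⟨T', hT'sub, hT'.transfer fun x hx t ht htx => ?_⟩
      have hst : b P' < t := (hT'' t ht).resolve_left fun h => hqT' (h ▸ ht)
      have hxH : x ∉ H := fun h => absurd (hHs x h) (not_le.2 (hst.trans_le htx.2))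
      have hxP : x ≠ P := fun h => hxH (h ▸ hPH)
      refine ⟨Finset.mem_insert_of_mem (Finset.mem_sdiff.2 ⟨hx, hxH⟩), fun t _ => ?_⟩
      simp [ivl, Function.update_of_ne hxP]

end Duality

/-! ### Staller wins on a thin set -/

section Staller

variable {ι α : Type*} [LinearOrder α]

/-- Thinness passes to a part `U` of `T` without gaps that is separated from the rest of `T`
by the remaining elements. -/
theorem Thin.restrict {N : ι → Set α} {F F' : Finset ι} {T U : Finset α} (h : Thin N F T)
    (hF : F' ⊆ F) (hU : U.Nonempty) (hUT : U ⊆ T)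
    (hconv : ∀ u ∈ U, ∀ v ∈ U, ∀ t ∈ T, u ≤ t → t ≤ v → t ∈ U)
    (hsep : ∀ x ∈ F', ∀ t ∈ U, t ∈ N x → ∀ t' ∈ T, t' ∈ N x → t' ∈ U) : Thin N F' U := by
  refine ⟨hU, fun u hu v hv huv hth =>
    h.2 u (hUT hu) v (hUT hv) huv fun p hp p' hp' h1 h2 h3 h4 => ?_⟩
  have hpU := hconv u hu v hv p hp h1 (h2.trans h3)
  obtain ⟨x, hx, y, hy, hxy, hx', hy'⟩ := hth p hpU p'
    (hconv u hu v hv p' hp' (h1.trans h2) h3) h1 h2 h3 (fun t ht => h4 t (hUT ht))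
  exact ⟨x, hF hx, y, hF hy, hxy,
    ⟨hx'.1, hx'.2.1, fun t ht htx => hx'.2.2 t (hsep x hx p hpU hx'.1 t ht htx) htx⟩,
    ⟨hy'.1, hy'.2.1, fun t ht hty => hy'.2.2 t (hsep y hy p hpU hy'.1 t ht hty) hty⟩⟩

/-- One round of play on a thin set: as the window consisting of all of `T` is not thick, there is
a point of `T`, or a pair of consecutive points, that at most one element `x` contains. Once `x` is
removed, no element meets both sides of this place, so one of the sides avoids `y`. -/
theorem Thin.exists_reply [DecidableEq ι] {a b : ι → α} {F : Finset ι} {T : Finset α}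
    (h : Thin (ivl a b) F T) (hF : F.Nonempty) : ∃ x ∈ F, ∀ y ∈ F, y ≠ x →
      ∃ U ⊆ T, Thin (ivl a b) ((F.erase x).erase y) U ∧ ∀ t ∈ U, t ∉ ivl a b y := by
  have hnth := h.2 _ (T.min'_mem h.1) _ (T.max'_mem h.1) (T.min'_le _ (T.max'_mem h.1))
  unfold Thick at hnth
  push Not at hnth
  obtain ⟨p, hp, p', hp', -, hpp, -, hcons, huniq⟩ := hnth
  obtain ⟨x, hx, hxF⟩ : ∃ x ∈ F, ∀ y ∈ F, y ≠ x → ¬ (p ∈ ivl a b y ∧ p' ∈ ivl a b y) := by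
    by_cases hex : ∃ x ∈ F, p ∈ ivl a b x ∧ p' ∈ ivl a b x
    · obtain ⟨x, hx, hpx, hpx'⟩ := hex
      refine ⟨x, hx, fun y hy hyx hpy => ?_⟩
      obtain ⟨t, ht, -, htn⟩ := huniq x hx y hy hyx.symm
        ⟨hpx, hpx', fun t ht _ => ⟨T.min'_le t ht, T.le_max' t ht⟩⟩ hpy.1 hpy.2
      exact absurd (T.le_max' t ht) (not_le.2 (htn (T.min'_le t ht)))
    · obtain ⟨x, hx⟩ := hF
      exact ⟨x, hx, fun y hy _ hpy => hex ⟨y, hy, hpy⟩⟩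
  have hcut : ∀ y ∈ F, y ≠ x → ∀ t, t ∈ ivl a b y → t ≤ p → ∀ t', t' ∈ ivl a b y → ¬ p' ≤ t' :=
    fun y hy hyx t ht htp t' ht' htp' => hxF y hy hyx
      ⟨⟨ht.1.trans htp, hpp.trans (htp'.trans ht'.2)⟩,
        ⟨ht.1.trans (htp.trans hpp), htp'.trans ht'.2⟩⟩
  have hside : ∀ t ∈ T, t ≤ p ∨ p' ≤ t := fun t ht => by
    rcases le_or_gt t p with h | h
    · exact Or.inl h
    · exact Or.inr (hcons t ht h)
  refine ⟨x, hx, fun y hy hyx => ?_⟩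
  have hmem : ∀ z ∈ (F.erase x).erase y, z ∈ F ∧ z ≠ x := fun z hz =>
    ⟨Finset.mem_of_mem_erase (Finset.mem_of_mem_erase hz),
      Finset.ne_of_mem_erase (Finset.mem_of_mem_erase hz)⟩
  by_cases hy' : ∃ t ∈ T, t ≤ p ∧ t ∈ ivl a b y
  · obtain ⟨t₀, -, ht₀p, ht₀⟩ := hy'
    refine ⟨T.filter (p' ≤ ·), Finset.filter_subset _ _, h.restrict (fun z hz => (hmem z hz).1)
      ⟨p', Finset.mem_filter.2 ⟨hp', le_rfl⟩⟩ (Finset.filter_subset _ _) ?_ ?_, ?_⟩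
    · exact fun u hu _ _ t ht hut _ =>
        Finset.mem_filter.2 ⟨ht, (Finset.mem_filter.1 hu).2.trans hut⟩
    · intro z hz t ht htz t' ht' htz'
      refine Finset.mem_filter.2 ⟨ht', (hside t' ht').resolve_left fun h' => ?_⟩
      exact hcut z (hmem z hz).1 (hmem z hz).2 t' htz' h' t htz (Finset.mem_filter.1 ht).2
    · exact fun t ht hty => hcut y hy hyx t₀ ht₀ ht₀p t hty (Finset.mem_filter.1 ht).2
  · refine ⟨T.filter (· ≤ p), Finset.filter_subset _ _, h.restrict (fun z hz => (hmem z hz).1)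
      ⟨p, Finset.mem_filter.2 ⟨hp, le_rfl⟩⟩ (Finset.filter_subset _ _) ?_ ?_, ?_⟩
    · exact fun _ _ v hv t ht _ htv =>
        Finset.mem_filter.2 ⟨ht, htv.trans (Finset.mem_filter.1 hv).2⟩
    · intro z hz t ht htz t' ht' htz'
      refine Finset.mem_filter.2 ⟨ht', (hside t' ht').resolve_right fun h' => ?_⟩
      exact hcut z (hmem z hz).1 (hmem z hz).2 t htz (Finset.mem_filter.1 ht).2 t' htz' h'
    · exact fun t ht hty => hy' ⟨t, (Finset.mem_filter.1 ht).1, (Finset.mem_filter.1 ht).2, hty⟩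

/-- If the points of `T` encode closed neighborhoods that Dominator has not met, and `T` is thin for
the unclaimed vertices, then Staller, to move, wins. -/
theorem Thin.not_dominatorWins {V : Type*} [Fintype V] [DecidableEq V] {G : SimpleGraph V}
    {a b : V → α} : ∀ {D S : Finset V} {T : Finset α}, Thin (ivl a b) (D ∪ S)ᶜ T →
      (∀ t ∈ T, ∃ m, ∀ x, x ∈ closedNbhd G m ↔ t ∈ ivl a b x) →
      (∀ t ∈ T, ∀ d ∈ D, t ∉ ivl a b d) → ¬ DominatorWins G Player.staller D S := by
  suffices H : ∀ n, ∀ {D S : Finset V} {T : Finset α}, (D ∪ S)ᶜ.card = n →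
      Thin (ivl a b) (D ∪ S)ᶜ T → (∀ t ∈ T, ∃ m, ∀ x, x ∈ closedNbhd G m ↔ t ∈ ivl a b x) →
      (∀ t ∈ T, ∀ d ∈ D, t ∉ ivl a b d) → ¬ DominatorWins G Player.staller D S from
    fun {_ _ _} h1 h2 h3 => H _ rfl h1 h2 h3
  intro n
  induction n using Nat.strong_induction_on with
  | _ n ih =>
  intro D S T hn hT henc hD hwin
  have hnd : ¬ IsDominatingSet G (D : Set V) := fun hdom => by
    obtain ⟨t, ht⟩ := hT.1
    obtain ⟨m, hm⟩ := henc t ht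
    obtain ⟨d, hd, hdm⟩ := hdom m
    exact hD t ht d hd ((hm d).1 hdm)
  cases hwin with
  | dominated _ _ _ hdom => exact hnd hdom
  | stallerMove _ _ hne hmove =>
    obtain ⟨x₀, hx₀⟩ := hne
    obtain ⟨x, hx, hreply⟩ := hT.exists_reply ⟨x₀, Finset.mem_compl.2 hx₀⟩
    have hx' := Finset.mem_compl.1 hx
    cases hmove x hx' with
    | dominated _ _ _ hdom => exact hnd hdom
    | dominatorMove _ _ y hy hwin =>
      have hy' : y ∉ D ∪ S ∧ y ≠ x := by
        simp only [Finset.mem_union, Finset.mem_insert, not_or] at hy ⊢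
        tauto
      obtain ⟨U, hUT, hU, hyU⟩ := hreply y (Finset.mem_compl.2 hy'.1) hy'.2
      have hF : (insert y D ∪ insert x S)ᶜ = ((D ∪ S)ᶜ.erase x).erase y := by
        ext z
        simp only [Finset.mem_compl, Finset.mem_union, Finset.mem_insert, Finset.mem_erase]
        tauto
      refine ih _ ?_ rfl (hF ▸ hU) (fun t ht => henc t (hUT ht)) ?_ hwin
      · rw [hF, ← hn]
        exact lt_of_le_of_lt (Finset.card_le_card (Finset.erase_subset _ _))
          (Finset.card_erase_lt_of_mem hx)
      · intro t ht d hd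
        rcases Finset.mem_insert.1 hd with rfl | hd
        · exact hyU t ht
        · exact hD t (hUT ht) d hd

end Staller

/-! ### The pairing strategy -/

section Dominator

variable {V : Type*} {G : SimpleGraph V}

theorem mem_closedNbhd {u v : V} : u ∈ closedNbhd G v ↔ u = v ∨ G.Adj v u := Iff.rfl

theorem mem_closedNbhd_comm {u v : V} : u ∈ closedNbhd G v ↔ v ∈ closedNbhd G u := by
  rw [mem_closedNbhd, mem_closedNbhd, eq_comm, G.adj_comm]

/-- The pairing strategy, with Staller to move: each pair is either met by Dominator or still
entirely unclaimed, and Dominator maintains this by answering in the pair in which Staller plays. -/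
theorem dominatorWins_of_pairing [Fintype V] [DecidableEq V] {k : ℕ} {u v : Fin k → V}
    (hinj : Function.Injective (Sum.elim u v))
    (hcov : (⋃ i : Fin k, closedNbhd G (u i) ∩ closedNbhd G (v i)) = Set.univ) :
    ∀ {D S : Finset V},
      (∀ i, (u i ∈ D ∨ v i ∈ D) ∨ (u i ∉ D ∪ S ∧ v i ∉ D ∪ S)) →
      DominatorWins G Player.staller D S := by
  suffices H : ∀ n, ∀ {D S : Finset V}, (D ∪ S)ᶜ.card = n →
      (∀ i, (u i ∈ D ∨ v i ∈ D) ∨ (u i ∉ D ∪ S ∧ v i ∉ D ∪ S)) →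
      DominatorWins G Player.staller D S from fun {_ _} h => H _ rfl h
  have hdom : ∀ {D : Finset V}, (∀ i, u i ∈ D ∨ v i ∈ D) → IsDominatingSet G (D : Set V) := by
    intro D hD w
    obtain ⟨i, hi⟩ := Set.mem_iUnion.1 (hcov ▸ Set.mem_univ w)
    rcases hD i with h | h
    · exact ⟨u i, h, mem_closedNbhd_comm.1 hi.1⟩
    · exact ⟨v i, h, mem_closedNbhd_comm.1 hi.2⟩
  rw [Sum.elim_injective] at hinj
  obtain ⟨hu, hv, huv⟩ := hinj
  intro n
  induction n using Nat.strong_induction_on with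
  | _ n ih =>
  intro D S hn hinv
  by_cases hne : ∃ x, x ∉ D ∪ S
  swap
  · push Not at hne
    exact .dominated _ _ _ (hdom fun i => (hinv i).resolve_right fun h => h.1 (hne _))
  refine .stallerMove _ _ hne fun x hx => ?_
  have hlt : ∀ z, (insert z D ∪ insert x S)ᶜ.card < n := by
    intro z
    rw [← hn]
    refine Finset.card_lt_card ((Finset.ssubset_iff_of_subset ?_).2 ⟨x, Finset.mem_compl.2 hx, ?_⟩)
    · intro w
      simp only [Finset.mem_compl, Finset.mem_union, Finset.mem_insert]
      tauto
    · simp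
  have hgoal : ∀ z, z ∉ D ∪ insert x S →
      (∀ i, (u i ∈ insert z D ∨ v i ∈ insert z D) ∨
        (u i ∉ insert z D ∪ insert x S ∧ v i ∉ insert z D ∪ insert x S)) →
      DominatorWins G Player.dominator D (insert x S) := fun z hz h =>
    .dominatorMove _ _ z hz (ih _ (hlt z) rfl h)
  simp only [Finset.mem_union, Finset.mem_insert, not_or] at hgoal hinv hx
  by_cases hpair : ∃ i, ¬ (u i ∈ D ∨ v i ∈ D) ∧ (x = u i ∨ x = v i)
  · obtain ⟨i, hi, hxi⟩ := hpair
    have hfree := (hinv i).resolve_left hi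
    have hother : ∀ j, j ≠ i → x ≠ u j ∧ x ≠ v j := by
      intro j hj
      rcases hxi with rfl | rfl
      · exact ⟨fun h => hj (hu h).symm, huv i j⟩
      · exact ⟨fun h => huv j i h.symm, fun h => hj (hv h).symm⟩
    rcases hxi with rfl | rfl
    · refine hgoal (v i) ⟨hfree.2.1, (huv i i).symm, hfree.2.2⟩ fun j => ?_
      by_cases hj : j = i
      · subst hj; exact Or.inl (Or.inr (Or.inl rfl))
      · rcases hinv j with h | h
        · tauto
        · have h1 : u j ≠ v i := huv j i
          have h2 : v j ≠ v i := fun h => hj (hv h)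
          have h3 := hother j hj
          exact Or.inr ⟨⟨⟨h1, h.1.1⟩, h3.1.symm, h.1.2⟩, ⟨h2, h.2.1⟩, h3.2.symm, h.2.2⟩
    · refine hgoal (u i) ⟨hfree.1.1, huv i i, hfree.1.2⟩ fun j => ?_
      by_cases hj : j = i
      · subst hj; exact Or.inl (Or.inl (Or.inl rfl))
      · rcases hinv j with h | h
        · tauto
        · have h1 : u j ≠ u i := fun h => hj (hu h)
          have h2 : v j ≠ u i := (huv i j).symm
          have h3 := hother j hj
          exact Or.inr ⟨⟨⟨h1, h.1.1⟩, h3.1.symm, h.1.2⟩, ⟨h2, h.2.1⟩, h3.2.symm, h.2.2⟩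
  · push Not at hpair
    by_cases hz : ∃ z, z ∉ D ∪ insert x S
    · obtain ⟨z, hz⟩ := hz
      simp only [Finset.mem_union, Finset.mem_insert, not_or] at hz
      refine hgoal z hz fun j => ?_
      by_cases hj : u j ∈ D ∨ v j ∈ D
      · tauto
      · have h := (hinv j).resolve_left hj
        have h' := hpair j (not_or.1 hj)
        by_cases h1 : u j = z
        · tauto
        by_cases h2 : v j = z
        · tauto
        exact Or.inr ⟨⟨⟨h1, h.1.1⟩, Ne.symm h'.1, h.1.2⟩, ⟨h2, h.2.1⟩, Ne.symm h'.2, h.2.2⟩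
    · push Not at hz
      refine .dominated _ _ _ (hdom fun i => ?_)
      by_contra hi
      have h := (hinv i).resolve_left hi
      have h' := hpair i (not_or.1 hi)
      have := hz (u i)
      simp only [Finset.mem_union, Finset.mem_insert] at this
      rcases this with h1 | h1 | h1
      · exact h.1.1 h1
      · exact h'.1 h1.symm
      · exact h.1.2 h1

theorem HasPairingDominatingSet.hasOutcomeD [Fintype V] [DecidableEq V]
    (h : HasPairingDominatingSet G) : HasOutcomeD G := by
  obtain ⟨k, u, v, hinj, hcov⟩ := h
  intro p
  cases p with
  | staller => exact dominatorWins_of_pairing hinj hcov fun i => Or.inr (by simp)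
  | dominator =>
    rcases isEmpty_or_nonempty V with hV | ⟨⟨x⟩⟩
    · exact .dominated _ _ _ fun w => hV.elim w
    · refine .dominatorMove _ _ x (by simp) (dominatorWins_of_pairing hinj hcov fun i => ?_)
      -- an extra vertex of Dominator does no harm to the invariant
      by_cases h : u i = x ∨ v i = x
      · left; simpa using h
      · right; simpa using h

end Dominator

/-! ### Interval graphs -/

section IntervalGraph

variable {V : Type*} [Fintype V] {G : SimpleGraph V}

/-- The closed neighborhoods of the vertices `m` with inclusion-minimal intervals are encoded by
points `t = r m`: new intervals `[a x, b x]` represent the membership in these neighborhoods.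
These vertices suffice for domination, as any other closed neighborhood contains one of them. -/
theorem IsIntervalGraph.exists_points (hG : IsIntervalGraph G) :
    ∃ (a b : V → ℝ) (T : Finset ℝ),
      (∀ t ∈ T, ∃ m, ∀ x, x ∈ closedNbhd G m ↔ t ∈ ivl a b x) ∧
      ∀ v, ∃ t ∈ T, ∀ x, t ∈ ivl a b x → x ∈ closedNbhd G v := by
  classical
  obtain ⟨l, r, hlr, hadj⟩ := hG
  have hmem : ∀ m x, x ∈ closedNbhd G m ↔ l x ≤ r m ∧ l m ≤ r x := by
    intro m x
    rw [mem_closedNbhd]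
    by_cases hx : x = m
    · simp [hx, hlr]
    rw [hadj m x (Ne.symm hx), Set.Icc_inter_Icc, Set.nonempty_Icc]
    simp only [hx, false_or, max_le_iff, le_min_iff, hlr, true_and, and_true]
  let M : Finset V := Finset.univ.filter fun m =>
    ∀ u, l m ≤ l u → r u ≤ r m → l u ≤ l m ∧ r m ≤ r u
  have hM : ∀ m, m ∈ M ↔ ∀ u, l m ≤ l u → r u ≤ r m → l u ≤ l m ∧ r m ≤ r u := by simp [M]
  have hbelow : ∀ v, ∃ m ∈ M, l v ≤ l m ∧ r m ≤ r v := by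
    intro v
    -- a shortest interval inside that of `v` is inclusion-minimal
    obtain ⟨m, hm, hmin⟩ := Finset.exists_min_image
      (Finset.univ.filter fun m => l v ≤ l m ∧ r m ≤ r v) (fun m => r m - l m) ⟨v, by simp⟩
    have hm' := (Finset.mem_filter.1 hm).2
    refine ⟨m, (hM m).2 fun u h1 h2 => ?_, hm'⟩
    have := hmin u (Finset.mem_filter.2 ⟨Finset.mem_univ _, hm'.1.trans h1, h2.trans hm'.2⟩)
    constructor <;> linarith
  -- the right end of the last minimal interval that starts before the interval of `x` ends
  let b : V → ℝ := fun x => if h : (M.filter fun m => l m ≤ r x).Nonempty then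
    (M.filter fun m => l m ≤ r x).sup' h r else l x - 1
  have henc : ∀ m ∈ M, ∀ x, x ∈ closedNbhd G m ↔ r m ∈ ivl l b x := by
    intro m hm x
    rw [hmem, ivl, Set.mem_Icc]
    refine and_congr_right fun hx => ⟨fun h => ?_, fun h => ?_⟩
    · have hm' : m ∈ M.filter fun m => l m ≤ r x := Finset.mem_filter.2 ⟨hm, h⟩
      have hb : b x = (M.filter fun m => l m ≤ r x).sup' ⟨m, hm'⟩ r := dif_pos _
      exact hb ▸ Finset.le_sup' r hm'
    · by_cases hne : (M.filter fun m => l m ≤ r x).Nonempty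
      · simp only [b, dif_pos hne] at h
        obtain ⟨m', hm', h'⟩ := Finset.exists_mem_eq_sup' hne r
        rw [h'] at h
        obtain ⟨hm'M, hm'x⟩ := Finset.mem_filter.1 hm'
        -- minimal intervals have their left ends in the order of their right ends
        refine le_trans ?_ hm'x
        by_contra hlt
        exact hlt ((hM m').1 hm'M m (not_le.1 hlt).le h).1
      · simp only [b, dif_neg hne] at h
        linarith
  refine ⟨l, b, M.image r, fun t ht => ?_, fun v => ?_⟩
  · obtain ⟨m, hm, rfl⟩ := Finset.mem_image.1 ht
    exact ⟨m, henc m hm⟩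
  · obtain ⟨m, hm, h1, h2⟩ := hbelow v
    refine ⟨r m, Finset.mem_image_of_mem r hm, fun x hx => ?_⟩
    have := (hmem m x).1 ((henc m hm x).2 hx)
    exact (hmem v x).2 ⟨this.1.trans h2, h1.trans this.2⟩

theorem IsIntervalGraph.hasPairingDominatingSet [DecidableEq V] (hG : IsIntervalGraph G)
    (h : DominatorWinsSecond G) : HasPairingDominatingSet G := by
  obtain ⟨a, b, T, henc, hT⟩ := hG.exists_points
  rcases pairCover_or_exists_thin Finset.univ a b T with hc | ⟨U, hUT, hU⟩
  · obtain ⟨k, u, v, hinj, -, hcov⟩ := hc.exists_families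
    refine ⟨k, u, v, hinj, Set.eq_univ_of_forall fun w => ?_⟩
    obtain ⟨t, ht, htw⟩ := hT w
    obtain ⟨i, hi⟩ := hcov t ht
    exact Set.mem_iUnion.2 ⟨i, mem_closedNbhd_comm.1 (htw _ hi.1),
      mem_closedNbhd_comm.1 (htw _ hi.2)⟩
  · have hU' : Thin (ivl a b) ((∅ : Finset V) ∪ ∅)ᶜ U := by simpa using hU
    exact absurd h (hU'.not_dominatorWins (fun t ht => henc t (hUT ht)) (by simp))

end IntervalGraph

theorem mainTheorem1 {V : Type*} [Fintype V] [DecidableEq V] (G : SimpleGraph V)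
    (hG : IsIntervalGraph G) :
    (HasOutcomeD G ↔ HasPairingDominatingSet G) ∧
      (DominatorWinsSecond G ↔ HasPairingDominatingSet G) :=
  ⟨⟨fun h => hG.hasPairingDominatingSet (h Player.staller), fun h => h.hasOutcomeD⟩,
    ⟨fun h => hG.hasPairingDominatingSet h, fun h => h.hasOutcomeD Player.staller⟩⟩
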